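/- **Model.** A dynamic network on the node set $V=\{1,\dots,n\}$ is a sequence of simple graphs $G_0,G_1,G_2,\dots$ on $V$, where $G_i$ is the graph in round $i$. In going from $G_{i-1}$ to $G_i$ an arbitrary set of edges is inserted and deleted; $\mathrm{changes}(i)$ is the total number of edge insertions and deletions in rounds $1,\dots,i$. Each node knows $n$, its identifier, the current round number and its incident edges, and stores a label (its color) and a local memory. In round $i$ each node first learns which of its incident edges have just changed and may do a local computation (possibly changing its label); then it sends a message (a bit string) to each of its neighbors in $G_i$; then it receives the messages of its neighbors in $G_i$ and does a further local computation (possibly changing its label). The algorithm is deterministic, and local computation is free. For a coloring $c:V\to\mathbb N$, the star centered at $v$ is *consistent* for (degree+1)-coloring in $G_i$ if $c(v)\in\{1,\dots,\deg_{G_i}(v)+1\}$ and $c(u)\ne c(v)$ for all neighbors $u$ of $v$ in $G_i$. It is *consistent in round $i$* if it is so for the labels just before the messages of round $i$ are sent and for the labels at the end of round $i$. Let $\mathrm{incorrect}(i)$ be the number of rounds among $0,\dots,i$ in which at least one star is inconsistent. **Theorem.** There are a deterministic distributed algorithm (defined for every $n$) and constants $k$ and $C$ such that for every $n$, every dynamic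 network $G_0,G_1,\dots$ on $n$ nodes and every initial labeling for which all stars are consistent in $G_0$ (in particular for the edgeless $G_0$, where every node has color $1$), the following hold. 1. (Fixing.) If the star of a node $v$ is inconsistent in round $i$, then there is a round $j>i$ in which the star of $v$ is consistent, or at the start of which an edge incident to $v$ or to a neighbor of $v$ in $G_i$ is inserted or deleted. 2. ($O(1)$ amortized rounds.) $\mathrm{incorrect}(i)\le k\cdot\mathrm{changes}(i)$ for every round $i$. 3. ($O(\log n)$-bit messages.) Every message sent has at most $C\lfloor\log_2 n\rfloor$ bits. -/

import Mathlib

/-- The labelled star centred at `v` is consistent for (degree+1)-coloring: `v` has a color in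
`{1, …, deg v + 1}` that differs from the colors of all its neighbours. -/
def StarConsistent {n : ℕ} (G : SimpleGraph (Fin n)) (c : Fin n → ℕ) (v : Fin n) : Prop :=
  1 ≤ c v ∧ c v ≤ (G.neighborSet v).ncard + 1 ∧ ∀ u, G.Adj v u → c u ≠ c v

/-- A (degree+1)-coloring: every labelled star is consistent. -/
def IsDegPlusOneColoring {n : ℕ} (G : SimpleGraph (Fin n)) (c : Fin n → ℕ) : Prop :=
  ∀ v, StarConsistent G c v

open Classical in
/-- The neighbours of `v`. -/
noncomputable def nbrs {n : ℕ} (G : SimpleGraph (Fin n)) (v : Fin n) : Finset (Fin n) :=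
  Finset.univ.filter fun u => G.Adj v u

open Classical in
/-- The set of edges inserted or deleted at the beginning of round `i` of the dynamic graph `G`,
whose graph in round `i` is `G i`. The graph `G 0` is the initial one. -/
noncomputable def changedEdges {n : ℕ} (G : ℕ → SimpleGraph (Fin n)) : ℕ → Finset (Sym2 (Fin n))
  | 0 => ∅
  | i + 1 => Finset.univ.filter fun e => ¬ (e ∈ (G i).edgeSet ↔ e ∈ (G (i + 1)).edgeSet)

open Classical in
/-- The indications that `v` receives in round `i`: the other endpoints of the edges at `v` that
were changed at the beginning of that round. -/
noncomputable def indications {n : ℕ} (G : ℕ → SimpleGraph (Fin n)) (i : ℕ) (v : Fin n) :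
    Finset (Fin n) :=
  Finset.univ.filter fun u => s(v, u) ∈ changedEdges G i

/-- The number of topology changes up to and including round `i`. -/
noncomputable def numChanges {n : ℕ} (G : ℕ → SimpleGraph (Fin n)) (i : ℕ) : ℕ :=
  ∑ j ∈ Finset.range (i + 1), (changedEdges G j).card

/-- A deterministic synchronous message-passing algorithm on `n` nodes with identifiers in `Fin n`.
Every node stores a label (a color, in `ℕ`) and a local memory, and knows `n`, its identifier, its
incident edges, and the number of the current round. All functions are local to a node: they see
only the node's own data, the indications it receives, and the messages it receives. -/
structure DynamicAlgorithm (n : ℕ) where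
  /-- local memory of a node -/
  Mem : Type
  /-- initial memory, from the identifier, the initial neighbours and the initial color -/
  init : Fin n → Finset (Fin n) → ℕ → Mem
  /-- local computation at the beginning of a round, from the identifier, the round number, the
  current neighbours, the indications, and the stored label and memory -/
  update : Fin n → ℕ → Finset (Fin n) → Finset (Fin n) → ℕ × Mem → ℕ × Mem
  /-- the bit string sent to a given neighbour (the last identifier) in the current round -/
  send : Fin n → ℕ → ℕ × Mem → Fin n → List Bool
  /-- local computation at the end of a round, from the messages received in it
  (`none` for a node that is not a neighbour) -/
  receive : Fin n → ℕ → ℕ × Mem → (Fin n → Option (List Bool)) → ℕ × Mem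

namespace DynamicAlgorithm

variable {n : ℕ} (A : DynamicAlgorithm n) (G : ℕ → SimpleGraph (Fin n)) (c₀ : Fin n → ℕ)

/-- Effect on all nodes of the indications and the local computation that open round `i`. -/
noncomputable def indicate (i : ℕ) (s : Fin n → ℕ × A.Mem) : Fin n → ℕ × A.Mem :=
  fun v => A.update v i (nbrs (G i) v) (indications G i v) (s v)

open Classical in
/-- Effect on all nodes of the message exchange of round `i`: messages travel along the edges of
`G i` only. -/
noncomputable def exchange (i : ℕ) (s : Fin n → ℕ × A.Mem) : Fin n → ℕ × A.Mem :=
  fun v => A.receive v i (s v) fun u =>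
    if (G i).Adj u v then some (A.send u i (s u) v) else none

/-- The configuration that is carried over into round `i`, when the execution starts with the
coloring `c₀` of `G 0`. -/
noncomputable def config : ℕ → Fin n → ℕ × A.Mem
  | 0 => fun v => (c₀ v, A.init v (nbrs (G 0) v) (c₀ v))
  | i + 1 => A.exchange G i (A.indicate G i (config i))

/-- The configuration in round `i` just before messages are sent. -/
noncomputable def midConfig (i : ℕ) : Fin n → ℕ × A.Mem :=
  A.indicate G i (A.config G c₀ i)

/-- The labelling at the beginning of round `i`, before the communication takes place. -/
noncomputable def labelBegin (i : ℕ) (v : Fin n) : ℕ := (A.midConfig G c₀ i v).1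

/-- The labelling at the end of round `i`. -/
noncomputable def labelEnd (i : ℕ) (v : Fin n) : ℕ := (A.config G c₀ (i + 1) v).1

/-- The star of `v` is consistent in round `i`, both at its beginning and at its end. -/
def StarConsistentIn (i : ℕ) (v : Fin n) : Prop :=
  StarConsistent (G i) (A.labelBegin G c₀ i) v ∧ StarConsistent (G i) (A.labelEnd G c₀ i) v

open Classical in
/-- The number of rounds, up to and including round `i`, in which some star is inconsistent. -/
noncomputable def numIncorrect (i : ℕ) : ℕ :=
  ((Finset.range (i + 1)).filter fun j => ∃ v, ¬ A.StarConsistentIn G c₀ j v).card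

/-- Fixing processes end: if the star of `v` is inconsistent in some round, then in some later
round it is consistent again, or an edge incident to `v` or to one of its neighbours is changed. -/
def FixesStars : Prop :=
  ∀ i v, ¬ A.StarConsistentIn G c₀ i v →
    ∃ j, i < j ∧ (A.StarConsistentIn G c₀ j v ∨
      ∃ e ∈ changedEdges G j, ∃ w ∈ e, w = v ∨ (G i).Adj v w)

/-- Amortized round complexity at most `k`: the number of incorrect rounds divided by the number
of changes never exceeds `k`, written without the division. While there has been no change, this
says that no round has been incorrect. -/
def AmortizedRoundsLE (k : ℕ) : Prop :=
  ∀ i, A.numIncorrect G c₀ i ≤ k * numChanges G i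

/-- Every message sent in the execution has at most `b` bits. -/
def MessageBitsLE (b : ℕ) : Prop :=
  ∀ i u v, (G i).Adj u v → (A.send u i (A.midConfig G c₀ i u) v).length ≤ b

end DynamicAlgorithm

/-! A node touched by a change becomes pending with age 1, and a pending node recolors greedily once
its (age, identifier) beats all neighbours. Adjacent nodes never recolor together, so the new colors
stay valid and every node that is not pending is consistent (`starConsistent_of_age_eq_zero`). The
globally highest pending node always recolors. Hence the number of pending nodes is a potential: a
changed edge raises it by at most 2, and an incorrect round lowers it (`numIncorrect_add_card_le`),
which gives k = 2. Since older nodes go first, no age exceeds n (`age_add_card_higher_le`); so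
messages are short, and no node left undisturbed stays pending forever. -/

/-- The natural number with the given binary digits, least significant first. -/
def natOfBits (l : List Bool) : ℕ := l.foldr Nat.bit 0

theorem natOfBits_bits (m : ℕ) : natOfBits m.bits = m := by
  induction m using Nat.binaryRec' with
  | zero => simp [natOfBits]
  | bit b m h ih =>
    rw [Nat.bits_append_bit m b h]
    simpa [natOfBits] using congrArg (Nat.bit b) ih

theorem length_bits_pair_le {n a b : ℕ} (hn : 2 ≤ n) (ha : a ≤ n) (hb : b ≤ n) :
    (Nat.pair a b).bits.length ≤ 4 * Nat.log 2 n := by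
  rw [Nat.size_eq_bits_len, Nat.size_le]
  have hlog : 1 ≤ Nat.log 2 n := Nat.log_pos (by norm_num) hn
  have hlt : n < 2 ^ (Nat.log 2 n + 1) := Nat.lt_pow_succ_log_self (by norm_num) n
  calc Nat.pair a b < (max a b + 1) ^ 2 := Nat.pair_lt_max_add_one_sq a b
    _ ≤ (2 ^ (Nat.log 2 n + 1)) ^ 2 := Nat.pow_le_pow_left (by omega) 2
    _ = 2 ^ (2 * (Nat.log 2 n + 1)) := by rw [← pow_mul, mul_comm]
    -- As the logarithm is at least 1, the rounding term is absorbed: 2(log + 1) ≤ 4 log.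
    _ ≤ 2 ^ (4 * Nat.log 2 n) := Nat.pow_le_pow_right (by norm_num) (by omega)

/-- The least positive color outside `S`. -/
noncomputable def freeColor (S : Set ℕ) : ℕ := sInf {c | 1 ≤ c ∧ c ∉ S}

/-- Pigeonhole: `S` cannot contain all of 1, …, |S| + 1. -/
theorem freeColor_spec {S : Set ℕ} (hS : S.Finite) :
    1 ≤ freeColor S ∧ freeColor S ∉ S ∧ freeColor S ≤ S.ncard + 1 := by
  obtain ⟨c, hc, hcS⟩ : ∃ c ∈ Finset.Icc 1 (S.ncard + 1), c ∉ S := by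
    by_contra! h
    have hle := Set.ncard_le_ncard (s := ↑(Finset.Icc 1 (S.ncard + 1))) (fun c hc => h c hc) hS
    rw [Set.ncard_coe_finset, Nat.card_Icc] at hle
    omega
  rw [Finset.mem_Icc] at hc
  have hne : {c | 1 ≤ c ∧ c ∉ S}.Nonempty := ⟨c, hc.1, hcS⟩
  have hmem : freeColor S ∈ {c | 1 ≤ c ∧ c ∉ S} := Nat.sInf_mem hne
  exact ⟨hmem.1, hmem.2, (Nat.sInf_le (show c ∈ {c | 1 ≤ c ∧ c ∉ S} from ⟨hc.1, hcS⟩)).trans hc.2⟩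

/-- Priorities of nodes: first by age, then by identifier. -/
def priority {n : ℕ} (a : ℕ) (v : Fin n) : ℕ ×ₗ Fin n := toLex (a, v)

theorem priority_lt {n : ℕ} {a b : ℕ} {u v : Fin n} :
    priority a u < priority b v ↔ a < b ∨ a = b ∧ u < v := Prod.Lex.toLex_lt_toLex

open Classical in
/-- The oldest-first recoloring algorithm. The memory of a node is its age: `0` if no recoloring is
pending, and otherwise the number of rounds, including the current one, since an incident edge was
last changed. A node with a pending recoloring takes the least free color once its priority
exceeds those of its neighbours. -/
noncomputable def oldestFirst (n : ℕ) : DynamicAlgorithm n where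
  Mem := ℕ
  init _ _ _ := 0
  update _ _ _ ind s := (s.1, if ind = ∅ then s.2 else 1)
  send _ _ s _ := (Nat.pair s.1 s.2).bits
  receive v _ s msg :=
    if 0 < s.2 ∧ ∀ u, ∀ l ∈ msg u, priority (natOfBits l).unpair.2 u < priority s.2 v then
      (freeColor {c | ∃ u, ∃ l ∈ msg u, (natOfBits l).unpair.1 = c}, 0)
    else (s.1, if s.2 = 0 then 0 else s.2 + 1)

/-! ### One round as a recursion on colors and ages -/

section Execution

variable {n : ℕ} (G : ℕ → SimpleGraph (Fin n)) (c₀ : Fin n → ℕ)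

/-- The color of `v` when round `i` starts, before and after the indications. -/
noncomputable def color (i : ℕ) (v : Fin n) : ℕ := ((oldestFirst n).config G c₀ i v).1

/-- The age of `v` that is carried over into round `i`. -/
noncomputable def oldAge (i : ℕ) (v : Fin n) : ℕ := ((oldestFirst n).config G c₀ i v).2

open Classical in
/-- The age of `v` in round `i` after the indications. -/
noncomputable def age (i : ℕ) (v : Fin n) : ℕ :=
  if indications G i v = ∅ then oldAge G c₀ i v else 1

/-- In round `i`, the node `v` takes a new color. -/
def Recolors (i : ℕ) (v : Fin n) : Prop :=
  0 < age G c₀ i v ∧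
    ∀ u, (G i).Adj u v → priority (age G c₀ i u) u < priority (age G c₀ i v) v

theorem midConfig_eq (i : ℕ) (v : Fin n) :
    (oldestFirst n).midConfig G c₀ i v = (color G c₀ i v, age G c₀ i v) := by
  classical
  simp only [DynamicAlgorithm.midConfig, DynamicAlgorithm.indicate, age, color, oldAge]
  rfl

theorem labelBegin_eq (i : ℕ) : (oldestFirst n).labelBegin G c₀ i = color G c₀ i := by
  funext v
  rw [DynamicAlgorithm.labelBegin, midConfig_eq]

theorem labelEnd_eq (i : ℕ) : (oldestFirst n).labelEnd G c₀ i = color G c₀ (i + 1) := rfl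

open Classical in
theorem config_succ (i : ℕ) (v : Fin n) :
    (oldestFirst n).config G c₀ (i + 1) v =
      if Recolors G c₀ i v then (freeColor (color G c₀ i '' (G i).neighborSet v), 0)
      else (color G c₀ i v, if age G c₀ i v = 0 then 0 else age G c₀ i v + 1) := by
  have hmsg : ∀ u l, l ∈ (if (G i).Adj u v then
      some ((oldestFirst n).send u i ((oldestFirst n).midConfig G c₀ i u) v) else none) ↔
      (G i).Adj u v ∧ (Nat.pair (color G c₀ i u) (age G c₀ i u)).bits = l := by
    intro u l
    rw [midConfig_eq]
    split_ifs with h <;> simp [h, oldestFirst]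
  change (oldestFirst n).receive v i ((oldestFirst n).midConfig G c₀ i v) _ = _
  rw [midConfig_eq]
  change (if _ ∧ _ then _ else _) = _
  have hrec : (0 < age G c₀ i v ∧ ∀ u, ∀ l ∈ (if (G i).Adj u v then
      some ((oldestFirst n).send u i ((oldestFirst n).midConfig G c₀ i u) v) else none),
      priority (natOfBits l).unpair.2 u < priority (age G c₀ i v) v) ↔ Recolors G c₀ i v := by
    simp only [Recolors, hmsg]
    refine and_congr_right fun _ => forall_congr' fun u => ⟨fun h hu => ?_, ?_⟩
    · simpa [natOfBits_bits] using h _ ⟨hu, rfl⟩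
    · rintro h _ ⟨hu, rfl⟩
      simpa [natOfBits_bits] using h hu
  have hset : {c | ∃ u, ∃ l ∈ (if (G i).Adj u v then
      some ((oldestFirst n).send u i ((oldestFirst n).midConfig G c₀ i u) v) else none),
      (natOfBits l).unpair.1 = c} = color G c₀ i '' (G i).neighborSet v := by
    ext c
    simp only [hmsg, Set.mem_ofPred_eq, Set.mem_image, SimpleGraph.mem_neighborSet]
    constructor
    · rintro ⟨u, _, ⟨hu, rfl⟩, rfl⟩
      exact ⟨u, hu.symm, by simp [natOfBits_bits]⟩
    · rintro ⟨u, hu, rfl⟩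
      exact ⟨u, _, ⟨hu.symm, rfl⟩, by simp [natOfBits_bits]⟩
  rw [← hset]
  exact if_congr hrec rfl rfl

variable {G c₀} {i : ℕ} {u v : Fin n}

theorem color_succ_of_recolors (h : Recolors G c₀ i v) :
    color G c₀ (i + 1) v = freeColor (color G c₀ i '' (G i).neighborSet v) := by
  rw [color, config_succ, if_pos h]

theorem color_succ_of_not_recolors (h : ¬ Recolors G c₀ i v) :
    color G c₀ (i + 1) v = color G c₀ i v := by
  rw [color, config_succ, if_neg h]

theorem oldAge_succ_of_recolors (h : Recolors G c₀ i v) : oldAge G c₀ (i + 1) v = 0 := by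
  rw [oldAge, config_succ, if_pos h]

theorem oldAge_succ_of_age_eq_zero (h : age G c₀ i v = 0) : oldAge G c₀ (i + 1) v = 0 := by
  rw [oldAge, config_succ, if_neg fun hr => hr.1.ne' h, if_pos h]

theorem oldAge_succ_of_not_recolors (h : ¬ Recolors G c₀ i v) (ha : age G c₀ i v ≠ 0) :
    oldAge G c₀ (i + 1) v = age G c₀ i v + 1 := by
  rw [oldAge, config_succ, if_neg h, if_neg ha]

theorem oldAge_zero : oldAge G c₀ 0 v = 0 := rfl

theorem indications_zero : indications G 0 v = ∅ := by
  simp [indications, changedEdges]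

theorem age_zero : age G c₀ 0 v = 0 := by
  rw [age, if_pos indications_zero, oldAge_zero]

/-- The indications reveal whether the neighbourhood of a node has changed. -/
theorem adj_succ_iff (h : indications G (i + 1) v = ∅) (u : Fin n) :
    (G (i + 1)).Adj v u ↔ (G i).Adj v u := by
  classical
  have hu : u ∉ indications G (i + 1) v := by simp [h]
  rw [indications, Finset.mem_filter_univ, changedEdges, Finset.mem_filter_univ, not_not] at hu
  exact hu.symm

/-- Priorities are compared strictly, so the recoloring nodes form an independent set. -/
theorem not_recolors_of_adj (h : Recolors G c₀ i v) (hu : (G i).Adj u v) :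
    ¬ Recolors G c₀ i u := fun h' => lt_asymm (h.2 u hu) (h'.2 v hu.symm)

theorem ncard_neighborSet_lt (H : SimpleGraph (Fin n)) (v : Fin n) :
    (H.neighborSet v).ncard < n := by
  have := Set.ncard_lt_card (s := H.neighborSet v)
    ((Set.ne_univ_iff_exists_notMem _).2 ⟨v, by simp⟩)
  simpa using this

theorem freeColor_image_spec (H : SimpleGraph (Fin n)) (c : Fin n → ℕ) (v : Fin n) :
    1 ≤ freeColor (c '' H.neighborSet v) ∧
      freeColor (c '' H.neighborSet v) ≤ (H.neighborSet v).ncard + 1 ∧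
      ∀ u, H.Adj v u → c u ≠ freeColor (c '' H.neighborSet v) := by
  obtain ⟨h1, h2, h3⟩ := freeColor_spec (Set.toFinite (c '' H.neighborSet v))
  exact ⟨h1, h3.trans (Nat.succ_le_succ (Set.ncard_image_le (Set.toFinite _))),
    fun u hu h => h2 ⟨u, hu, h⟩⟩

/-! ### Nodes without a pending recoloring are consistent -/

/-- An exchange of messages leaves every node without a pending recoloring consistent. -/
theorem starConsistent_succ
    (h : ∀ v, age G c₀ i v = 0 → StarConsistent (G i) (color G c₀ i) v)
    (hv : oldAge G c₀ (i + 1) v = 0) : StarConsistent (G i) (color G c₀ (i + 1)) v := by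
  by_cases hr : Recolors G c₀ i v
  · obtain ⟨h1, h2, h3⟩ := freeColor_image_spec (G i) (color G c₀ i) v
    rw [StarConsistent, color_succ_of_recolors hr]
    refine ⟨h1, h2, fun u hu => ?_⟩
    rw [color_succ_of_not_recolors (not_recolors_of_adj hr hu.symm)]
    exact h3 u hu
  · have ha : age G c₀ i v = 0 := by
      by_contra ha
      rw [oldAge_succ_of_not_recolors hr ha] at hv
      omega
    obtain ⟨h1, h2, h3⟩ := h v ha
    rw [StarConsistent, color_succ_of_not_recolors hr]
    refine ⟨h1, h2, fun u hu => ?_⟩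
    by_cases hu' : Recolors G c₀ i u
    · rw [color_succ_of_recolors hu']
      -- The new color of `u` avoids the color of `v`, which `v` keeps.
      exact ((freeColor_image_spec (G i) (color G c₀ i) u).2.2 v hu.symm).symm
    · rw [color_succ_of_not_recolors hu']
      exact h3 u hu

theorem starConsistent_of_age_eq_zero (h₀ : IsDegPlusOneColoring (G 0) c₀) (i : ℕ) (v : Fin n)
    (hv : age G c₀ i v = 0) : StarConsistent (G i) (color G c₀ i) v := by
  induction i generalizing v with
  | zero => exact h₀ v
  | succ i ih =>
    have hind : indications G (i + 1) v = ∅ := by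
      by_contra hne
      rw [age, if_neg hne] at hv
      omega
    rw [age, if_pos hind] at hv
    -- Without indications, the star at the end of the previous round is still the current one.
    have hN : (G (i + 1)).neighborSet v = (G i).neighborSet v := Set.ext (adj_succ_iff hind)
    obtain ⟨h1, h2, h3⟩ := starConsistent_succ ih hv
    exact ⟨h1, hN ▸ h2, fun u hu => h3 u ((adj_succ_iff hind u).1 hu)⟩

theorem age_pos_of_not_starConsistentIn (h₀ : IsDegPlusOneColoring (G 0) c₀)
    (h : ¬ (oldestFirst n).StarConsistentIn G c₀ i v) : 0 < age G c₀ i v := by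
  refine Nat.pos_of_ne_zero fun ha => h ?_
  rw [DynamicAlgorithm.StarConsistentIn, labelBegin_eq, labelEnd_eq]
  exact ⟨starConsistent_of_age_eq_zero h₀ i v ha,
    starConsistent_succ (starConsistent_of_age_eq_zero h₀ i) (oldAge_succ_of_age_eq_zero ha)⟩

theorem color_le (h₀ : IsDegPlusOneColoring (G 0) c₀) (i : ℕ) (v : Fin n) :
    color G c₀ i v ≤ n := by
  induction i with
  | zero => exact (h₀ v).2.1.trans (ncard_neighborSet_lt _ v)
  | succ i ih =>
    by_cases hr : Recolors G c₀ i v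
    · rw [color_succ_of_recolors hr]
      exact (freeColor_image_spec _ _ v).2.1.trans (ncard_neighborSet_lt _ v)
    · rwa [color_succ_of_not_recolors hr]

/-! ### Bound on the ages, message length and fixing -/

/-- The pending node of the highest priority recolors. -/
theorem exists_recolors (h : 0 < age G c₀ i v) :
    ∃ w, Recolors G c₀ i w ∧ priority (age G c₀ i v) v ≤ priority (age G c₀ i w) w := by
  obtain ⟨w, -, hw⟩ := Finset.exists_max_image Finset.univ
    (fun u => priority (age G c₀ i u) u) ⟨v, Finset.mem_univ v⟩
  refine ⟨w, ⟨?_, fun u hu => ?_⟩, hw v (Finset.mem_univ v)⟩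
  · have := not_lt.2 (hw v (Finset.mem_univ v))
    rw [priority_lt] at this
    omega
  · refine lt_of_le_of_ne (hw u (Finset.mem_univ u)) fun he => hu.ne ?_
    exact congrArg (fun p => (ofLex p).2) he

open Classical in
/-- The nodes whose priority exceeds that of `v`. -/
noncomputable def higher (G : ℕ → SimpleGraph (Fin n)) (c₀ : Fin n → ℕ) (i : ℕ) (v : Fin n) :
    Finset (Fin n) :=
  Finset.univ.filter fun u => priority (age G c₀ i v) v < priority (age G c₀ i u) u

/-- While `v` waits, its age grows by 1 each round, but the highest node recolors and leaves
`higher`, and nobody enters; so the sum does not grow. A new indication restarts the age at 1, with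
at most n − 1 nodes above. -/
theorem age_add_card_higher_le (i : ℕ) (v : Fin n) (hv : 0 < age G c₀ i v) :
    age G c₀ i v + (higher G c₀ i v).card ≤ n := by
  have hone : ∀ j, age G c₀ j v = 1 → age G c₀ j v + (higher G c₀ j v).card ≤ n := by
    intro j hj
    have : (higher G c₀ j v).card < Fintype.card (Fin n) :=
      Finset.card_lt_univ_of_notMem (x := v) (by simp [higher])
    rw [Fintype.card_fin] at this
    omega
  induction i with
  | zero => simp [age_zero] at hv
  | succ i ih =>
    by_cases hind : indications G (i + 1) v = ∅
    swap
    · exact hone _ (if_neg hind)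
    have hage : age G c₀ (i + 1) v = oldAge G c₀ (i + 1) v := if_pos hind
    have hr : ¬ Recolors G c₀ i v := fun hr => by
      rw [hage, oldAge_succ_of_recolors hr] at hv
      omega
    have ha : age G c₀ i v ≠ 0 := fun ha => by
      rw [hage, oldAge_succ_of_age_eq_zero ha] at hv
      omega
    rw [oldAge_succ_of_not_recolors hr ha] at hage
    have hih := ih (Nat.pos_of_ne_zero ha)
    obtain ⟨w, hw, hvw⟩ := exists_recolors (Nat.pos_of_ne_zero ha)
    -- A node indicated in this round has age 1, below the age of `v`, which is at least 2; the
    -- other pending nodes age in step with `v`, so no one overtakes it.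
    have hold : ∀ u ∈ higher G c₀ (i + 1) v, ¬ Recolors G c₀ i u ∧ u ∈ higher G c₀ i v := by
      intro u hu
      simp only [higher, Finset.mem_filter_univ, priority_lt, hage] at hu ⊢
      by_cases hindu : indications G (i + 1) u = ∅
      swap
      · have : age G c₀ (i + 1) u = 1 := if_neg hindu
        omega
      have hageu : age G c₀ (i + 1) u = oldAge G c₀ (i + 1) u := if_pos hindu
      have hru : ¬ Recolors G c₀ i u := fun hru => by
        rw [oldAge_succ_of_recolors hru] at hageu
        omega
      have hau : age G c₀ i u ≠ 0 := fun hau => by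
        rw [oldAge_succ_of_age_eq_zero hau] at hageu
        omega
      rw [oldAge_succ_of_not_recolors hru hau] at hageu
      exact ⟨hru, by omega⟩
    have hlt : (higher G c₀ (i + 1) v).card < (higher G c₀ i v).card := by
      refine Finset.card_lt_card ((Finset.ssubset_iff_of_subset fun u hu => (hold u hu).2).2
        ⟨w, ?_, fun hw' => (hold w hw').1 hw⟩)
      simp only [higher, Finset.mem_filter_univ]
      refine lt_of_le_of_ne hvw fun he => hr ?_
      have : v = w := congrArg (fun p => (ofLex p).2) he
      exact this ▸ hw
    omega

theorem age_le (i : ℕ) (v : Fin n) : age G c₀ i v ≤ n := by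
  rcases Nat.eq_zero_or_pos (age G c₀ i v) with h | h
  · omega
  · have := age_add_card_higher_le i v h
    omega

theorem oldestFirst_messageBitsLE (h₀ : IsDegPlusOneColoring (G 0) c₀) :
    (oldestFirst n).MessageBitsLE G c₀ (4 * Nat.log 2 n) := by
  intro i u v huv
  rw [midConfig_eq]
  refine length_bits_pair_le ?_ (color_le h₀ i u) (age_le i u)
  -- An edge has two distinct ends in `Fin n`, so n ≥ 2.
  have := huv.ne
  omega

theorem oldestFirst_fixesStars (h₀ : IsDegPlusOneColoring (G 0) c₀) :
    (oldestFirst n).FixesStars G c₀ := by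
  intro i v hv
  by_contra! hcon
  have hpos : ∀ t, 0 < age G c₀ (i + t) v := by
    rintro (_ | t)
    · exact age_pos_of_not_starConsistentIn h₀ hv
    · exact age_pos_of_not_starConsistentIn h₀ (hcon _ (by omega)).1
  have hind : ∀ t, indications G (i + t + 1) v = ∅ := by
    intro t
    refine Finset.eq_empty_of_forall_notMem fun u hu => ?_
    simp only [indications, Finset.mem_filter_univ] at hu
    exact ((hcon (i + t + 1) (by omega)).2 _ hu v (Sym2.mem_mk_left v u)).1 rfl
  -- Always pending and never indicated again, `v` would age without bound.
  have hgrow : ∀ t, t < age G c₀ (i + t) v := by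
    intro t
    induction t with
    | zero => exact hpos 0
    | succ t ih =>
      have hage : age G c₀ (i + t + 1) v = oldAge G c₀ (i + t + 1) v := if_pos (hind t)
      have hp : 0 < age G c₀ (i + t + 1) v := hpos (t + 1)
      have hr : ¬ Recolors G c₀ (i + t) v := fun hr => by
        rw [hage, oldAge_succ_of_recolors hr] at hp
        omega
      rw [oldAge_succ_of_not_recolors hr (hpos t).ne'] at hage
      rw [← add_assoc, hage]
      omega
  have := hgrow n
  have := age_le (G := G) (c₀ := c₀) (i + n) v
  omega

/-! ### Amortization: the number of pending nodes as a potential -/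

theorem card_filter_indications_le (G : ℕ → SimpleGraph (Fin n)) (i : ℕ) :
    (Finset.univ.filter fun v => indications G i v ≠ ∅).card ≤ 2 * (changedEdges G i).card := by
  have hsub : (Finset.univ.filter fun v => indications G i v ≠ ∅) ⊆
      (changedEdges G i).biUnion Sym2.toFinset := by
    intro v hv
    rw [Finset.mem_filter_univ, ← Finset.nonempty_iff_ne_empty] at hv
    obtain ⟨u, hu⟩ := hv
    simp only [indications, Finset.mem_filter_univ] at hu
    exact Finset.mem_biUnion.2 ⟨_, hu, by simp⟩
  rw [mul_comm]
  refine (Finset.card_le_card hsub).trans (Finset.card_biUnion_le_card_mul _ _ 2 fun e _ => ?_)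
  rw [Sym2.card_toFinset]
  split_ifs <;> omega

theorem card_age_pos_le (G : ℕ → SimpleGraph (Fin n)) (c₀ : Fin n → ℕ) (i : ℕ) :
    (Finset.univ.filter fun v => 0 < age G c₀ i v).card ≤
      (Finset.univ.filter fun v => 0 < oldAge G c₀ i v).card + 2 * (changedEdges G i).card := by
  refine le_trans ?_ (Nat.add_le_add_left (card_filter_indications_le G i) _)
  refine (Finset.card_le_card fun v hv => ?_).trans (Finset.card_union_le _ _)
  rw [Finset.mem_union, Finset.mem_filter_univ, Finset.mem_filter_univ]
  rw [Finset.mem_filter_univ, age] at hv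
  split_ifs at hv with h
  · exact Or.inl hv
  · exact Or.inr h

theorem age_pos_of_oldAge_succ_pos (h : 0 < oldAge G c₀ (i + 1) v) : 0 < age G c₀ i v :=
  Nat.pos_of_ne_zero fun ha => h.ne' (oldAge_succ_of_age_eq_zero ha)

theorem card_oldAge_succ_pos_le (G : ℕ → SimpleGraph (Fin n)) (c₀ : Fin n → ℕ) (i : ℕ) :
    (Finset.univ.filter fun v => 0 < oldAge G c₀ (i + 1) v).card ≤
      (Finset.univ.filter fun v => 0 < age G c₀ i v).card :=
  Finset.card_le_card (Finset.monotone_filter_right _ fun _ _ => age_pos_of_oldAge_succ_pos)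

theorem card_oldAge_succ_pos_lt (h : 0 < age G c₀ i v) :
    (Finset.univ.filter fun v => 0 < oldAge G c₀ (i + 1) v).card <
      (Finset.univ.filter fun v => 0 < age G c₀ i v).card := by
  obtain ⟨w, hw, -⟩ := exists_recolors h
  refine Finset.card_lt_card ((Finset.ssubset_iff_of_subset
    (Finset.monotone_filter_right _ fun _ _ => age_pos_of_oldAge_succ_pos)).2 ⟨w, ?_, ?_⟩)
  · simpa using hw.1
  · simp [oldAge_succ_of_recolors hw]

/-- Keeping the potential on the left makes the induction telescope: each incorrect round is paid
for by a node that stops being pending. -/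
theorem numIncorrect_add_card_le (h₀ : IsDegPlusOneColoring (G 0) c₀) (i : ℕ) :
    (oldestFirst n).numIncorrect G c₀ i +
      (Finset.univ.filter fun v => 0 < oldAge G c₀ (i + 1) v).card ≤ 2 * numChanges G i := by
  classical
  have hstep : ∀ j, (if ∃ v, ¬ (oldestFirst n).StarConsistentIn G c₀ j v then 1 else 0) +
      (Finset.univ.filter fun v => 0 < oldAge G c₀ (j + 1) v).card ≤
      (Finset.univ.filter fun v => 0 < oldAge G c₀ j v).card + 2 * (changedEdges G j).card := by
    intro j
    refine le_trans ?_ (card_age_pos_le G c₀ j)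
    split_ifs with h
    · obtain ⟨v, hv⟩ := h
      have := card_oldAge_succ_pos_lt (age_pos_of_not_starConsistentIn h₀ hv)
      omega
    · simpa using card_oldAge_succ_pos_le G c₀ j
  have hinc : ∀ j, (oldestFirst n).numIncorrect G c₀ j = ∑ l ∈ Finset.range (j + 1),
      if ∃ v, ¬ (oldestFirst n).StarConsistentIn G c₀ l v then 1 else 0 := by
    intro j
    rw [DynamicAlgorithm.numIncorrect, Finset.card_filter]
  rw [hinc, numChanges]
  induction i with
  | zero => simpa [oldAge_zero, -Finset.sum_boole] using hstep 0
  | succ i ih =>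
    rw [Finset.sum_range_succ, Finset.sum_range_succ _ (i + 1)]
    have := hstep (i + 1)
    omega

theorem oldestFirst_amortizedRoundsLE (h₀ : IsDegPlusOneColoring (G 0) c₀) :
    (oldestFirst n).AmortizedRoundsLE G c₀ 2 := fun i =>
  (Nat.le_add_right _ _).trans (numIncorrect_add_card_le h₀ i)

end Execution

theorem mainTheorem5 :
    ∃ (A : (n : ℕ) → DynamicAlgorithm n) (k C : ℕ),
      ∀ (n : ℕ) (G : ℕ → SimpleGraph (Fin n)) (c₀ : Fin n → ℕ),
        IsDegPlusOneColoring (G 0) c₀ →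
          (A n).FixesStars G c₀ ∧
          (A n).AmortizedRoundsLE G c₀ k ∧
          (A n).MessageBitsLE G c₀ (C * Nat.log 2 n) :=
  ⟨oldestFirst, 2, 4, fun _ _ _ h₀ =>
    ⟨oldestFirst_fixesStars h₀, oldestFirst_amortizedRoundsLE h₀, oldestFirst_messageBitsLE h₀⟩⟩
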